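/- Let $R$ be a ring (associative with $1$), not necessarily commutative; modules are right $R$-modules. For a module $T$, let $\operatorname{Add}T$ be the class of all modules isomorphic to direct summands of direct sums of copies of $T$, let $T^{\perp}=\{M : \operatorname{Ext}^i_R(T,M)=0 \text{ for all } i>0\}$, and let $\mathcal X_{T}=\{M\in T^\perp : \operatorname{Hom}_R(T,M)=0\}$. A module $T$ is a *tilting module* (of projective dimension at most one) if $\operatorname{pd}T\le 1$, $\operatorname{Ext}^1_R(T,T^{(I)})=0$ for every set $I$, and there is an exact sequence $0\to R\to T_0\to T_1\to 0$ with $T_0,T_1\in\operatorname{Add}T$. Two tilting modules $T,T'$ are *equivalent* if $T^\perp=T'^\perp$. A full subcategory of $\operatorname{Mod}R$ is a *Giraud subcategory* if its inclusion into $\operatorname{Mod}R$ has an exact left adjoint. A *Gabriel topology* on $R$ is a non-empty set $\mathcal G$ of right ideals such that: (a) every right ideal containing a member of $\mathcal G$ is in $\mathcal G$; (b) $I,K\in\mathcal G$ implies $I\cap K\in\mathcal G$; (c) if $I\in\mathcal G$ and $x\in R$ then $(I:x)=\{r\in R : xr\in I\}\in\mathcal G$; (d) if $K$ is a right ideal and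 there is $I\in\mathcal G$ with $(K:x)\in\mathcal G$ for all $x\in I$, then $K\in\mathcal G$. A module $C$ is *$\mathcal G$-closed* if for every $I\in\mathcal G$ the restriction map $\operatorname{Hom}_R(R,C)\to\operatorname{Hom}_R(I,C)$ is bijective. The inclusion of the full subcategory of $\mathcal G$-closed modules into $\operatorname{Mod}R$ has a left adjoint; the reflection $R\to Q_{\mathcal G}$ of the module $R$ induces a ring structure on $Q_{\mathcal G}$ for which it is a ring homomorphism $\lambda_{\mathcal G}:R\to Q_{\mathcal G}$. The topology $\mathcal G$ is *perfect* if the $\mathcal G$-closed modules are exactly the modules in the essential image of the restriction functor $\operatorname{Mod}Q_{\mathcal G}\to\operatorname{Mod}R$ along $\lambda_{\mathcal G}$. **Theorem.** Let $T$ be a tilting right $R$-module (of projective dimension at most one). The following are equivalent: 1. There is an exact sequence $0\to R\to T_0\to T_1\to 0$ of right $R$-modules such that $T_0,T_1\in\operatorname{Add}T$, $\operatorname{Hom}_R(T_1,T_0)=0$, and $\mathcal X_{T_1}$ is a Giraud subcategory of $\operatorname{Mod}R$. 2. $T$ arises from perfect localization: there is a perfect Gabriel topology $\mathcal G$ on $R$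 such that $\lambda_{\mathcal G}:R\to Q_{\mathcal G}$ is injective and $Q_{\mathcal G}\oplus Q_{\mathcal G}/R$ is a tilting right $R$-module equivalent to $T$. -/

import Mathlib

open CategoryTheory Limits MulOpposite

universe u

/-- The category of right `R`-modules: a right `R`-module is a (left) module over the opposite
ring, with `x r` written `op r • x`. In particular `Submodule Rᵐᵒᵖ R` is the lattice of right
ideals of `R`. -/
abbrev RightMod (R : Type u) [Ring R] := ModuleCat.{u} Rᵐᵒᵖ

namespace RightMod

variable {R : Type u} [Ring R]

/-- `M` belongs to `Add T`: it is isomorphic to a direct summand of a direct sum of copies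
of `T`. -/
def Add (T : RightMod R) : ObjectProperty (RightMod R) := fun M =>
  ∃ (I : Type u) (N : RightMod R), Nonempty ((M × N) ≃ₗ[Rᵐᵒᵖ] (I →₀ T))

/-- The class `T^⊥` of all right modules `M` with `Ext^i(T, M) = 0` for all `i > 0`. -/
def extPerp (T : RightMod R) : ObjectProperty (RightMod R) := fun M =>
  ∀ i : ℕ, 0 < i → Subsingleton (Abelian.Ext.{u} T M i)

/-- The perpendicular category of `T`: all right modules `M` with `Hom(T, M) = 0` and
`Ext^i(T, M) = 0` for all `i > 0`. -/
def perpCat (T : RightMod R) : ObjectProperty (RightMod R) := fun M =>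
  (∀ f : T →ₗ[Rᵐᵒᵖ] M, f = 0) ∧ extPerp T M

/-- Short exact sequences `0 → R → T₀ → T₁ → 0` of right modules with `T₀, T₁ ∈ Add T`. -/
structure AddCoresolution (T T₀ T₁ : RightMod R) where
  /-- the map `R → T₀` -/
  f : R →ₗ[Rᵐᵒᵖ] T₀
  /-- the map `T₀ → T₁` -/
  g : T₀ →ₗ[Rᵐᵒᵖ] T₁
  injective : Function.Injective f
  exact : Function.Exact f g
  surjective : Function.Surjective g
  mem_add₀ : Add T T₀
  mem_add₁ : Add T T₁

/-- Tilting right modules (of projective dimension at most one). -/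
structure IsTilting (T : RightMod R) : Prop where
  projDim_le_one : HasProjectiveDimensionLE T 1
  ext_directSum : ∀ I : Type u,
    Subsingleton (Abelian.Ext.{u} T (ModuleCat.of Rᵐᵒᵖ (I →₀ T)) 1)
  coresolution : ∃ T₀ T₁ : RightMod R, Nonempty (AddCoresolution T T₀ T₁)

/-- Two tilting modules are equivalent if their tilting classes coincide. -/
def TiltingEquivalent (T T' : RightMod R) : Prop := extPerp T = extPerp T'

/-- A full subcategory of the category of right modules is a Giraud subcategory if its
inclusion functor has an exact left adjoint, that is, a left adjoint that preserves finite
limits and finite colimits. -/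
def IsGiraud (P : ObjectProperty (RightMod R)) : Prop :=
  ∃ l : RightMod R ⥤ P.FullSubcategory,
    Nonempty (l ⊣ P.ι) ∧ PreservesFiniteLimits l ∧ PreservesFiniteColimits l

end RightMod

/-- For a right ideal `I` and `x ∈ R`, the right ideal `(I : x) = {r ∈ R | x r ∈ I}`. -/
def rightColon {R : Type u} [Ring R] (I : Submodule Rᵐᵒᵖ R) (x : R) : Submodule Rᵐᵒᵖ R :=
  I.comap (LinearMap.mulLeft Rᵐᵒᵖ x)

/-- Gabriel topologies on `R`, as sets of right ideals. -/
structure GabrielTopology (R : Type u) [Ring R] where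
  /-- the right ideals belonging to the topology -/
  ideals : Set (Submodule Rᵐᵒᵖ R)
  nonempty : ideals.Nonempty
  mem_of_le : ∀ I ∈ ideals, ∀ K : Submodule Rᵐᵒᵖ R, I ≤ K → K ∈ ideals
  inf_mem : ∀ I ∈ ideals, ∀ K ∈ ideals, I ⊓ K ∈ ideals
  colon_mem : ∀ I ∈ ideals, ∀ x : R, rightColon I x ∈ ideals
  mem_of_colon_mem : ∀ K : Submodule Rᵐᵒᵖ R,
    (∃ I ∈ ideals, ∀ x ∈ I, rightColon K x ∈ ideals) → K ∈ ideals

/-- The category of modules over a ring is locally presentable. -/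
theorem moduleCat_isLocallyPresentable (A : Type u) [Ring A] :
    IsLocallyPresentable.{u} (ModuleCat.{u} A) := by
  have : Fact (Cardinal.aleph0.{u}).IsRegular := Cardinal.fact_isRegular_aleph0
  refine ⟨Cardinal.aleph0, this, ?_⟩
  rw [IsCardinalLocallyPresentable.iff_exists_isStrongGenerator]
  refine ⟨.singleton (ModuleCat.of A A), inferInstance, ?_, ?_⟩
  · rw [ObjectProperty.isStrongGenerator_iff]
    refine ⟨fun X Y f g h => ?_, fun X Y i _ h => ?_⟩
    · ext x
      have := h (ModuleCat.of A A) (by simp) (ModuleCat.ofHom (LinearMap.toSpanSingleton A X x))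
      simpa using congr($(this).hom (1 : A))
    · have h := h (ModuleCat.of A A) (by simp)
      have : Epi i := by
        rw [ModuleCat.epi_iff_surjective]
        intro y
        obtain ⟨f, hf⟩ := h (ModuleCat.ofHom (LinearMap.toSpanSingleton A Y y))
        refine ⟨f.hom (1 : A), ?_⟩
        simpa using congr($(hf).hom (1 : A))
      exact isIso_of_mono_of_epi i
  · intro X hX
    obtain rfl : ModuleCat.of A A = X := by simpa using hX
    change IsFinitelyPresentable _
    rw [isFinitelyPresentable_iff_preservesFilteredColimits]
    let e : forget (ModuleCat.{u} A) ≅ coyoneda.obj (Opposite.op (ModuleCat.of A A)) :=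
      NatIso.ofComponents (fun M => Equiv.toIso
        { toFun := fun x => ModuleCat.ofHom (LinearMap.toSpanSingleton A M x)
          invFun := fun f => f.hom (1 : A)
          left_inv := fun x => by simp
          right_inv := fun f => ModuleCat.hom_ext (LinearMap.ext_ring (by simp)) })
        (fun f => by
          ext x
          exact ModuleCat.hom_ext (LinearMap.ext_ring (by simp)))
    exact ⟨fun J _ _ => preservesColimitsOfShape_of_natIso e⟩

namespace GabrielTopology

variable {R : Type u} [Ring R] (G : GabrielTopology R)

/-- The `G`-closed right modules: those `C` for which restriction
`Hom(R, C) → Hom(I, C)` is bijective for every `I ∈ G`. -/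
def closed : ObjectProperty (RightMod R) := fun C =>
  ∀ I ∈ G.ideals, Function.Bijective
    (fun f : R →ₗ[Rᵐᵒᵖ] C => (f.comp I.subtype : I →ₗ[Rᵐᵒᵖ] C))

/-- The inclusion of the `G`-closed modules has a left adjoint. -/
instance isRightAdjoint_closed_ι : G.closed.ι.IsRightAdjoint := by
  have := moduleCat_isLocallyPresentable Rᵐᵒᵖ
  let W : MorphismProperty (RightMod R) :=
    .ofHoms (fun I : G.ideals => ModuleCat.ofHom I.1.subtype)
  have hW : G.closed = W.isLocal := by
    ext C
    constructor
    · rintro hC X Y f ⟨I⟩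
      have := hC I.1 I.2
      refine ⟨fun a b h => ?_, fun a => ?_⟩
      · exact ModuleCat.hom_ext (this.1 congr(($h).hom))
      · obtain ⟨b, hb⟩ := this.2 a.hom
        exact ⟨ModuleCat.ofHom b, ModuleCat.hom_ext hb⟩
    · intro hC I hI
      have := hC _ (MorphismProperty.ofHoms.mk (f := fun I : G.ideals =>
        ModuleCat.ofHom I.1.subtype) ⟨I, hI⟩)
      refine ⟨fun a b h => ?_, fun a => ?_⟩
      · exact congr($(this.1 (a₁ := ModuleCat.ofHom a) (a₂ := ModuleCat.ofHom b)
          (ModuleCat.hom_ext h)).hom)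
      · obtain ⟨b, hb⟩ := this.2 (ModuleCat.ofHom a)
        exact ⟨b.hom, congr(($hb).hom)⟩
  have hp : ∀ M : RightMod R, ∃ (κ : Cardinal.{u}) (_ : Fact κ.IsRegular),
      IsCardinalPresentable M κ := fun M =>
    (inferInstance : IsPresentable.{u} M).exists_cardinal
  choose κ hκ hM using hp
  let c : Cardinal.{u} := max (max Cardinal.aleph0 (κ (ModuleCat.of Rᵐᵒᵖ R)))
    (⨆ I : G.ideals, κ (ModuleCat.of Rᵐᵒᵖ I.1))
  have : Fact (Order.succ c).IsRegular :=
    ⟨Cardinal.isRegular_succ ((le_max_left _ _).trans (le_max_left _ _))⟩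
  rw [hW]
  refine MorphismProperty.isRightAdjoint_ι_isLocal W (Order.succ c) ?_
  rintro X Y f ⟨I⟩
  refine ⟨@isCardinalPresentable_of_le _ _ _ _ (hκ _) (hM _) _ _ ?_,
    @isCardinalPresentable_of_le _ _ _ _ (hκ _) (hM _) _ _ ?_⟩
  · refine le_trans ?_ (Order.le_succ c)
    exact (le_ciSup (f := fun I : G.ideals => κ (ModuleCat.of Rᵐᵒᵖ I.1))
      Cardinal.bddAbove_of_small I).trans (le_max_right _ _)
  · refine le_trans ?_ (Order.le_succ c)
    exact (le_max_right _ _).trans (le_max_left _ _)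

/-- The left adjoint `ℓ` of the inclusion of the `G`-closed modules. -/
noncomputable def reflector : RightMod R ⥤ G.closed.FullSubcategory :=
  G.closed.ι.leftAdjoint

/-- The adjunction between `ℓ` and the inclusion of the `G`-closed modules. -/
noncomputable def adj : G.reflector ⊣ G.closed.ι :=
  Adjunction.ofIsRightAdjoint G.closed.ι

/-- The localization `Q_G` of `R` at `G`, that is, the reflection of the right module `R` in
the category of `G`-closed modules. -/
def Q : Type u := (G.closed.ι.obj (G.reflector.obj (ModuleCat.of Rᵐᵒᵖ R)) : RightMod R)

noncomputable instance : AddCommGroup G.Q :=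
  inferInstanceAs
    (AddCommGroup (G.closed.ι.obj (G.reflector.obj (ModuleCat.of Rᵐᵒᵖ R)) : RightMod R))

noncomputable instance : Module Rᵐᵒᵖ G.Q :=
  inferInstanceAs
    (Module Rᵐᵒᵖ (G.closed.ι.obj (G.reflector.obj (ModuleCat.of Rᵐᵒᵖ R)) : RightMod R))

/-- The reflection map `R → Q_G`, the unit of the adjunction at `R`. -/
noncomputable def unit : R →ₗ[Rᵐᵒᵖ] G.Q :=
  (G.adj.unit.app (ModuleCat.of Rᵐᵒᵖ R)).hom

theorem closed_Q : G.closed (ModuleCat.of Rᵐᵒᵖ G.Q) :=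
  (G.reflector.obj (ModuleCat.of Rᵐᵒᵖ R)).property

/-- The universal property of the reflection `R → Q_G`. -/
theorem bijective_comp_unit (C : RightMod R) (hC : G.closed C) :
    Function.Bijective (fun f : G.Q →ₗ[Rᵐᵒᵖ] C => f.comp G.unit) := by
  let e := (ModuleCat.homEquiv (M := ModuleCat.of Rᵐᵒᵖ G.Q) (N := C)).symm.trans
    ((G.closed.fullyFaithfulι.homEquiv
      (X := G.reflector.obj (ModuleCat.of Rᵐᵒᵖ R)) (Y := ⟨C, hC⟩)).symm.trans
    ((G.adj.homEquiv _ _).trans ModuleCat.homEquiv))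
  have he : (fun f : G.Q →ₗ[Rᵐᵒᵖ] C => f.comp G.unit) = e := rfl
  rw [he]
  exact e.bijective

/-- For `x` in a `G`-closed module `C`, there is a unique linear map `Q_G → C` sending the
image of `1` to `x`. -/
theorem existsUnique_hom (C : RightMod R) (hC : G.closed C) (x : C) :
    ∃! f : G.Q →ₗ[Rᵐᵒᵖ] C, f (G.unit 1) = x := by
  have h1 (f : R →ₗ[Rᵐᵒᵖ] C) (r : R) : f r = op r • f 1 := by
    rw [← map_smul]; simp
  let f₀ : R →ₗ[Rᵐᵒᵖ] C :=
    { toFun := fun r => op r • x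
      map_add' := fun r s => by simp [add_smul]
      map_smul' := fun r s => by simp [mul_smul] }
  obtain ⟨f, hf⟩ := (G.bijective_comp_unit C hC).2 f₀
  refine ⟨f, ?_, fun g hg => (G.bijective_comp_unit C hC).1 ?_⟩
  · simpa [f₀] using LinearMap.congr_fun hf (1 : R)
  · refine Eq.trans ?_ hf.symm
    ext
    simpa [f₀] using hg

/-- Left multiplication by `q` on `Q_G`: the unique endomorphism of the right `R`-module `Q_G`
that sends the image of `1` to `q`. -/
noncomputable def mulLeft (q : G.Q) : G.Q →ₗ[Rᵐᵒᵖ] G.Q :=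
  (G.existsUnique_hom _ G.closed_Q q).choose

theorem mulLeft_unit_one (q : G.Q) : G.mulLeft q (G.unit 1) = q :=
  (G.existsUnique_hom _ G.closed_Q q).choose_spec.1

theorem hom_ext_Q {f g : G.Q →ₗ[Rᵐᵒᵖ] G.Q} (h : f (G.unit 1) = g (G.unit 1)) : f = g :=
  (G.existsUnique_hom _ G.closed_Q (g (G.unit 1))).unique h rfl

theorem mulLeft_unit (q : G.Q) (r : R) : G.mulLeft q (G.unit r) = op r • q := by
  have : G.unit r = op r • G.unit 1 := by rw [← map_smul]; simp
  rw [this, map_smul, mulLeft_unit_one]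

/-- The ring structure on `Q_G` induced by the reflection `R → Q_G`. -/
noncomputable instance : Ring G.Q where
  __ := (inferInstance : AddCommGroup G.Q)
  mul p q := G.mulLeft p q
  one := G.unit 1
  mul_assoc p q s := by
    change G.mulLeft (G.mulLeft p q) s = G.mulLeft p (G.mulLeft q s)
    refine LinearMap.congr_fun (G.hom_ext_Q (g := (G.mulLeft p).comp (G.mulLeft q)) ?_) s
    simp [mulLeft_unit_one]
  one_mul q := by
    change G.mulLeft (G.unit 1) q = q
    exact LinearMap.congr_fun (G.hom_ext_Q (g := LinearMap.id) (by simp [mulLeft_unit_one])) q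
  mul_one q := G.mulLeft_unit_one q
  left_distrib p q s := map_add (G.mulLeft p) q s
  right_distrib p q s := by
    change G.mulLeft (p + q) s = G.mulLeft p s + G.mulLeft q s
    exact LinearMap.congr_fun
      (G.hom_ext_Q (g := G.mulLeft p + G.mulLeft q) (by simp [mulLeft_unit_one])) s
  zero_mul q := by
    change G.mulLeft 0 q = 0
    exact LinearMap.congr_fun (G.hom_ext_Q (g := 0) (by simp [mulLeft_unit_one])) q
  mul_zero p := map_zero (G.mulLeft p)

/-- The ring homomorphism `λ_G : R → Q_G`, with the reflection `R → Q_G` as underlying map. -/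
noncomputable def toQ : R →+* G.Q where
  toFun := G.unit
  map_one' := rfl
  map_mul' r s := by
    change _ = G.mulLeft _ _
    rw [mulLeft_unit, ← map_smul]; simp
  map_zero' := map_zero G.unit
  map_add' := map_add G.unit

/-- The right `R`-module structure of `Q_G` is the one induced by `λ_G`. -/
theorem mul_toQ (q : G.Q) (r : R) : q * G.toQ r = op r • q :=
  G.mulLeft_unit q r

/-- A Gabriel topology is perfect if the `G`-closed modules are exactly the right `R`-modules
in the essential image of restriction of scalars along `λ_G : R → Q_G`. -/
def IsPerfect : Prop :=
  (ModuleCat.restrictScalars.{u} (RingHom.op G.toQ)).essImage = G.closed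

/-- The right `R`-module `Q_G ⊕ Q_G/R`, where `Q_G/R` is the quotient of `Q_G` by the image
of `R`. -/
noncomputable def sumQuotient : RightMod R :=
  ModuleCat.of Rᵐᵒᵖ (G.Q × (G.Q ⧸ LinearMap.range G.unit))

end GabrielTopology

/-- The tilting module `T` arises from perfect localization: there is a perfect Gabriel
topology `G` such that `R` embeds in `Q_G` and `Q_G ⊕ Q_G/R` is a tilting module equivalent
to `T`. -/
def RightMod.ArisesFromPerfectLocalization {R : Type u} [Ring R] (T : RightMod R) : Prop :=
  ∃ G : GabrielTopology R, G.IsPerfect ∧ Function.Injective G.toQ ∧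
    RightMod.IsTilting G.sumQuotient ∧
    RightMod.TiltingEquivalent G.sumQuotient T

/-! Write `f : R → T₀` and `g : T₀ → T₁` for a coresolution. Applying `Hom(-, M)` shows that every
`M` in `perpCat T₁` satisfies `Hom(T₀, M) ≅ Hom(R, M)` (`AddCoresolution.bijective_comp`). When
`Hom(T₁, T₀) = 0`, also `T₀` lies in `perpCat T₁`, so `f` is the reflection of `R` in that
subcategory.

From 1 to 2: a Giraud subcategory is the class of closed modules of the Gabriel topology of all `I`
such that `R/I` reflects to zero (`closed_gabrielTopology`). By uniqueness of reflections `T₀ ≅ Q_G`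
and `T₁ ≅ Q_G/R`, and for any coresolution `T₀ × T₁` is tilting and equivalent to `T`. Perfectness:
`Q_G`-modules are cokernels of maps between direct sums of copies of `T₀`, and `pd T₁ ≤ 1` makes
`perpCat T₁` closed under cokernels; conversely `M ≅ Hom(Q_G, M)` makes a closed `M` a `Q_G`-module.

From 2 to 1: with `T₀ = Q_G` and `T₁ = Q_G/R`, perfectness gives `G.closed = perpCat T₁`. Closed
modules are then closed under cokernels, whence the reflection is exact (`isGiraud_closed`).
Membership in `Add` passes between equivalent tilting modules, since `Add T` consists of the
Ext-projective objects of `T^⊥` (`IsTilting.add_of_ext_vanishing`). -/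

section ExtVanishing

/-! ### Vanishing of Ext through lifting properties -/

open Abelian

variable {C : Type*} [Category* C] [Abelian C] [HasExt.{u} C] {S : ShortComplex C}

theorem CategoryTheory.ShortComplex.ShortExact.subsingleton_ext_X₃ (hS : S.ShortExact) (X : C)
    (n : ℕ) (h₂ : Subsingleton (Ext.{u} X S.X₂ n)) (h₁ : Subsingleton (Ext.{u} X S.X₁ (n + 1))) :
    Subsingleton (Ext.{u} X S.X₃ n) := by
  refine subsingleton_of_forall_eq 0 fun x => ?_
  obtain ⟨y, rfl⟩ := Ext.covariant_sequence_exact₃ X hS x rfl (h₁.elim _ _)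
  rw [h₂.elim y 0, Ext.zero_comp]

theorem CategoryTheory.ShortComplex.ShortExact.subsingleton_ext_X₁ (hS : S.ShortExact) (X : C)
    (n : ℕ) (h₃ : Subsingleton (Ext.{u} X S.X₃ n)) (h₂ : Subsingleton (Ext.{u} X S.X₂ (n + 1))) :
    Subsingleton (Ext.{u} X S.X₁ (n + 1)) := by
  refine subsingleton_of_forall_eq 0 fun x => ?_
  obtain ⟨y, rfl⟩ := Ext.covariant_sequence_exact₁ X hS x (h₂.elim _ _) rfl
  rw [h₃.elim y 0, Ext.zero_comp]

theorem CategoryTheory.ShortComplex.ShortExact.exists_lift (hS : S.ShortExact) (X : C)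
    (h₁ : Subsingleton (Ext.{u} X S.X₁ 1)) (a : X ⟶ S.X₃) : ∃ b : X ⟶ S.X₂, b ≫ S.g = a := by
  obtain ⟨y, hy⟩ := Ext.covariant_sequence_exact₃ X hS (Ext.mk₀ a) rfl (h₁.elim _ _)
  obtain ⟨b, rfl⟩ := (Ext.mk₀_bijective _ _).2 y
  rw [Ext.mk₀_comp_mk₀] at hy
  exact ⟨b, (Ext.mk₀_bijective _ _).1 hy⟩

theorem CategoryTheory.ShortComplex.ShortExact.exists_extension (hS : S.ShortExact) (Y : C)
    (h₃ : Subsingleton (Ext.{u} S.X₃ Y 1)) (a : S.X₁ ⟶ Y) : ∃ b : S.X₂ ⟶ Y, S.f ≫ b = a := by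
  obtain ⟨y, hy⟩ := Ext.contravariant_sequence_exact₁ hS Y (Ext.mk₀ a) rfl (h₃.elim _ _)
  obtain ⟨b, rfl⟩ := (Ext.mk₀_bijective _ _).2 y
  rw [Ext.mk₀_comp_mk₀] at hy
  exact ⟨b, (Ext.mk₀_bijective _ _).1 hy⟩

/-- Liftability kills the connecting map, because `S.g` composed with the extension class is zero.
-/
theorem CategoryTheory.ShortComplex.ShortExact.subsingleton_ext_one_X₁ (hS : S.ShortExact) (X : C)
    (h : ∀ a : X ⟶ S.X₃, ∃ b : X ⟶ S.X₂, b ≫ S.g = a)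
    (h₂ : Subsingleton (Ext.{u} X S.X₂ 1)) : Subsingleton (Ext.{u} X S.X₁ 1) := by
  refine subsingleton_of_forall_eq 0 fun x => ?_
  obtain ⟨y, rfl⟩ := Ext.covariant_sequence_exact₁ X hS x (h₂.elim _ _) rfl
  obtain ⟨a, rfl⟩ := (Ext.mk₀_bijective _ _).2 y
  obtain ⟨b, rfl⟩ := h a
  rw [← Ext.mk₀_comp_mk₀, Ext.comp_assoc_of_second_deg_zero, hS.comp_extClass, Ext.comp_zero]

omit [HasExt.{u} C] in
theorem CategoryTheory.Injective.shortExact_under [EnoughInjectives C] (N : C) :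
    (ShortComplex.mk (Injective.ι N) (cokernel.π (Injective.ι N))
      (cokernel.condition _)).ShortExact where
  exact := ShortComplex.exact_cokernel _

/-- Vanishing of `Ext^{n+1}(-, N)` is detected by lifting properties, so it is inherited from `T`
by every `M` such that maps out of `M` lift along epimorphisms whenever maps out of `T` do. -/
theorem CategoryTheory.Abelian.subsingleton_ext_of_lifting [EnoughInjectives C] {T M : C}
    (h : ∀ {X Y : C} (g : X ⟶ Y), (∀ a : T ⟶ Y, ∃ b : T ⟶ X, b ≫ g = a) →
      ∀ a : M ⟶ Y, ∃ b : M ⟶ X, b ≫ g = a) (n : ℕ) :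
    ∀ N : C, Subsingleton (Ext.{u} T N (n + 1)) → Subsingleton (Ext.{u} M N (n + 1)) := by
  -- Dimension shifting along an embedding of `N` into an injective: `Ext¹` is the obstruction to
  -- lifting maps into the cokernel, and higher `Ext` reduces to that of the cokernel.
  induction n with
  | zero =>
    intro N hN
    have hS := Injective.shortExact_under N
    exact hS.subsingleton_ext_one_X₁ M (h _ (hS.exists_lift T hN))
      (Ext.subsingleton_of_injective _ _ _)
  | succ n ih =>
    intro N hN
    have hS := Injective.shortExact_under N
    exact hS.subsingleton_ext_X₁ M _
      (ih _ (hS.subsingleton_ext_X₃ T _ (Ext.subsingleton_of_injective _ _ _) hN))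
      (Ext.subsingleton_of_injective _ _ _)

end ExtVanishing

theorem ModuleCat.shortExact_mk {A : Type u} [Ring A] {X Y Z : ModuleCat.{u} A} (f : X →ₗ[A] Y)
    (g : Y →ₗ[A] Z) (hf : Function.Injective f) (hfg : Function.Exact f g)
    (hg : Function.Surjective g) :
    (ShortComplex.mk (ModuleCat.ofHom f) (ModuleCat.ofHom g)
      (ModuleCat.hom_ext hfg.linearMap_comp_eq_zero)).ShortExact :=
  ModuleCat.shortComplex_shortExact _ hfg hf hg

/-! ### `Add T`, tilting classes and coresolutions -/

namespace RightMod

open Abelian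

variable {R : Type u} [Ring R] {T M N K : RightMod R}

/-- Lifts are chosen on each copy of `T` and restricted along the splitting. This feeds
`subsingleton_ext_of_lifting`, so `Ext` of an infinite direct sum never has to be computed. -/
theorem Add.exists_lift (hM : Add T M) {X Y : RightMod R} (g : X ⟶ Y)
    (h : ∀ a : T ⟶ Y, ∃ b : T ⟶ X, b ≫ g = a) (a : M ⟶ Y) : ∃ b : M ⟶ X, b ≫ g = a := by
  obtain ⟨I, N, ⟨e⟩⟩ := hM
  let p : (I →₀ T) →ₗ[Rᵐᵒᵖ] M := LinearMap.fst _ _ _ ∘ₗ e.symm.toLinearMap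
  let s : M →ₗ[Rᵐᵒᵖ] (I →₀ T) := e.toLinearMap ∘ₗ LinearMap.inl _ _ _
  choose b hb using fun i : I => h (ModuleCat.ofHom (a.hom ∘ₗ p ∘ₗ Finsupp.lsingle i))
  refine ⟨ModuleCat.ofHom (Finsupp.lsum ℕ (fun i => (b i).hom) ∘ₗ s), ?_⟩
  have key : g.hom ∘ₗ Finsupp.lsum ℕ (fun i => (b i).hom) = a.hom ∘ₗ p := by
    ext i x
    simpa using congr(($(hb i)).hom x)
  ext x
  have := LinearMap.congr_fun key (s x)
  simpa [p, s] using this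

theorem Add.subsingleton_ext (hM : Add T M) (n : ℕ) (h : Subsingleton (Ext.{u} T N (n + 1))) :
    Subsingleton (Ext.{u} M N (n + 1)) :=
  subsingleton_ext_of_lifting hM.exists_lift n N h

theorem Add.extPerp_le (hM : Add T M) : extPerp T ≤ extPerp M := by
  rintro N hN (_ | i) hi
  · omega
  · exact hM.subsingleton_ext i (hN _ hi)

theorem Add.projDim_le_one (hM : Add T M) (hT : HasProjectiveDimensionLE T 1) :
    HasProjectiveDimensionLE M 1 := by
  refine HasProjectiveDimensionLT.mk fun i hi Y e => ?_
  obtain ⟨i, rfl⟩ : ∃ j, i = j + 1 := ⟨i - 1, by omega⟩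
  exact (hM.subsingleton_ext i (HasProjectiveDimensionLT.subsingleton T 2 _ hi Y)).elim _ _

theorem extPerp_iff (hT : HasProjectiveDimensionLE T 1) :
    extPerp T M ↔ Subsingleton (Ext.{u} T M 1) := by
  refine ⟨fun h => h 1 one_pos, fun h i hi => ?_⟩
  obtain rfl | hi : i = 1 ∨ 2 ≤ i := by omega
  · exact h
  · exact HasProjectiveDimensionLT.subsingleton T 2 i hi M

theorem extPerp_of_surjective (hT : HasProjectiveDimensionLE T 1) (g : M →ₗ[Rᵐᵒᵖ] N)
    (hg : Function.Surjective g) (hM : extPerp T M) : extPerp T N := by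
  rw [extPerp_iff hT] at hM ⊢
  exact (LinearMap.shortExact_shortComplexKer hg).subsingleton_ext_X₃ T 1 hM
    (HasProjectiveDimensionLT.subsingleton T 2 2 le_rfl _)

theorem extPerp_ker (hT : HasProjectiveDimensionLE T 1) (g : M →ₗ[Rᵐᵒᵖ] N)
    (hg : Function.Surjective g) (hM : extPerp T M)
    (h : ∀ a : T →ₗ[Rᵐᵒᵖ] N, ∃ b : T →ₗ[Rᵐᵒᵖ] M, g ∘ₗ b = a) :
    extPerp T (ModuleCat.of Rᵐᵒᵖ (LinearMap.ker g)) := by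
  rw [extPerp_iff hT] at hM ⊢
  refine (LinearMap.shortExact_shortComplexKer hg).subsingleton_ext_one_X₁ T (fun a => ?_) hM
  obtain ⟨b, hb⟩ := h a.hom
  exact ⟨ModuleCat.ofHom b, ModuleCat.hom_ext hb⟩

theorem exists_lift_of_subsingleton (g : M →ₗ[Rᵐᵒᵖ] N) (hg : Function.Surjective g)
    (h : Subsingleton (Ext.{u} T (ModuleCat.of Rᵐᵒᵖ (LinearMap.ker g)) 1)) (a : T →ₗ[Rᵐᵒᵖ] N) :
    ∃ b : T →ₗ[Rᵐᵒᵖ] M, g ∘ₗ b = a := by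
  obtain ⟨b, hb⟩ := (LinearMap.shortExact_shortComplexKer hg).exists_lift T h (ModuleCat.ofHom a)
  exact ⟨b.hom, congr(($hb).hom)⟩

theorem exists_extension_of_subsingleton {X Y Z : RightMod R} (f : X →ₗ[Rᵐᵒᵖ] Y)
    (g : Y →ₗ[Rᵐᵒᵖ] Z) (hf : Function.Injective f) (hfg : Function.Exact f g)
    (hg : Function.Surjective g) (h : Subsingleton (Ext.{u} Z M 1)) (a : X →ₗ[Rᵐᵒᵖ] M) :
    ∃ b : Y →ₗ[Rᵐᵒᵖ] M, b ∘ₗ f = a := by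
  obtain ⟨b, hb⟩ := (ModuleCat.shortExact_mk f g hf hfg hg).exists_extension M h
    (ModuleCat.ofHom a)
  exact ⟨b.hom, congr(($hb).hom)⟩

theorem perpCat_of_linearEquiv (e : M ≃ₗ[Rᵐᵒᵖ] N) (hM : perpCat T M) : perpCat T N := by
  refine ⟨fun f => ?_, fun i hi => ?_⟩
  · ext x
    simpa using LinearMap.congr_fun (hM.1 (e.symm.toLinearMap ∘ₗ f)) x
  · have := hM.2 i hi
    refine subsingleton_of_forall_eq 0 fun x => ?_
    have h : x = (x.comp (Ext.mk₀ e.toModuleIso.inv) (add_zero i)).comp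
        (Ext.mk₀ e.toModuleIso.hom) (add_zero i) := by
      rw [Ext.comp_assoc_of_second_deg_zero, Ext.mk₀_comp_mk₀, Iso.inv_hom_id, Ext.comp_mk₀_id]
    rw [h, Subsingleton.elim (x.comp _ _) 0, Ext.zero_comp]

theorem add_iff : Add T M ↔ ∃ (I : Type u) (p : (I →₀ T) →ₗ[Rᵐᵒᵖ] M) (s : M →ₗ[Rᵐᵒᵖ] (I →₀ T)),
    ∀ x, p (s x) = x := by
  constructor
  · rintro ⟨I, N, ⟨e⟩⟩
    exact ⟨I, LinearMap.fst _ _ _ ∘ₗ e.symm.toLinearMap, e.toLinearMap ∘ₗ LinearMap.inl _ _ _,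
      fun x => by simp⟩
  · rintro ⟨I, p, s, h⟩
    refine ⟨I, ModuleCat.of Rᵐᵒᵖ (LinearMap.ker p), ⟨LinearEquiv.ofLinearMap
      (s.coprod (LinearMap.ker p).subtype)
      (p.prod ((LinearMap.id - s ∘ₗ p).codRestrict _ fun x => by simp [h])) ?_ ?_⟩⟩
    · ext : 1
      simp
    · ext x : 2
      · exact Prod.ext (by simp [h]) (Subtype.ext (by simp [h]))
      · exact Prod.ext (by simp) (Subtype.ext (by simp))

theorem Add.refl (T : RightMod R) : Add T T :=
  add_iff.2 ⟨PUnit, Finsupp.lapply .unit, Finsupp.lsingle .unit, fun x => by simp⟩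

theorem Add.of_retract (hM : Add T M) (p : M →ₗ[Rᵐᵒᵖ] N) (s : N →ₗ[Rᵐᵒᵖ] M)
    (h : ∀ x, p (s x) = x) : Add T N := by
  obtain ⟨I, p', s', h'⟩ := add_iff.1 hM
  exact add_iff.2 ⟨I, p ∘ₗ p', s' ∘ₗ s, fun x => by simp [h, h']⟩

theorem Add.finsupp (hM : Add T M) (J : Type u) : Add T (ModuleCat.of Rᵐᵒᵖ (J →₀ M)) := by
  obtain ⟨I, p, s, h⟩ := add_iff.1 hM
  let e : (J × I →₀ T) ≃ₗ[Rᵐᵒᵖ] (J →₀ I →₀ T) := Finsupp.curryLinearEquiv Rᵐᵒᵖ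
  refine add_iff.2 ⟨J × I, Finsupp.mapRange.linearMap p ∘ₗ e.toLinearMap,
    e.symm.toLinearMap ∘ₗ Finsupp.mapRange.linearMap s, fun x => ?_⟩
  ext j
  simp [h]

theorem Add.prod (hM : Add T M) (hN : Add T N) : Add T (ModuleCat.of Rᵐᵒᵖ (M × N)) := by
  obtain ⟨I, p, s, h⟩ := add_iff.1 hM
  obtain ⟨J, q, t, h'⟩ := add_iff.1 hN
  let e : (I ⊕ J →₀ T) ≃ₗ[Rᵐᵒᵖ] (I →₀ T) × (J →₀ T) := Finsupp.sumFinsuppLEquivProdFinsupp Rᵐᵒᵖ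
  exact add_iff.2 ⟨I ⊕ J, p.prodMap q ∘ₗ e.toLinearMap, e.symm.toLinearMap ∘ₗ s.prodMap t,
    fun x => by simp [h, h']⟩

theorem IsTilting.extPerp_of_add (hT : IsTilting T) (hM : Add T M) : extPerp T M := by
  obtain ⟨I, p, s, h⟩ := add_iff.1 hM
  exact extPerp_of_surjective (M := ModuleCat.of Rᵐᵒᵖ (I →₀ T)) hT.projDim_le_one p
    (fun x => ⟨s x, h x⟩) ((extPerp_iff hT.projDim_le_one).2 (hT.ext_directSum I))

theorem exists_hom_apply_one (M : RightMod R) (x : M) : ∃ a : R →ₗ[Rᵐᵒᵖ] M, a 1 = x :=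
  ⟨{ toFun := fun r => op r • x
     map_add' := fun r s => by simp [add_smul]
     map_smul' := fun r s => by simp [mul_smul] }, by simp⟩

theorem hom_apply (a : R →ₗ[Rᵐᵒᵖ] M) (r : R) : a r = op r • a 1 := by
  rw [← map_smul]; simp

theorem hom_ext_one {a b : R →ₗ[Rᵐᵒᵖ] M} (h : a 1 = b 1) : a = b := by
  ext
  simpa using h

theorem AddCoresolution.exists_hom {T₀ T₁ : RightMod R} (c : AddCoresolution T T₀ T₁)
    (h : Subsingleton (Ext.{u} T₁ M 1)) (x : M) : ∃ b : T₀ →ₗ[Rᵐᵒᵖ] M, b (c.f 1) = x := by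
  obtain ⟨a, rfl⟩ := exists_hom_apply_one M x
  obtain ⟨b, hb⟩ := exists_extension_of_subsingleton (X := ModuleCat.of Rᵐᵒᵖ R) c.f c.g
    c.injective c.exact c.surjective h a
  exact ⟨b, LinearMap.congr_fun hb (1 : R)⟩

theorem exists_finsupp_surjective {Q : RightMod R} (h : ∀ x : M, ∃ b : Q →ₗ[Rᵐᵒᵖ] M, ∃ q, b q = x) :
    ∃ p : (M →₀ Q) →ₗ[Rᵐᵒᵖ] M, Function.Surjective p := by
  choose b q hq using h
  exact ⟨Finsupp.lsum ℕ b, fun x => ⟨Finsupp.single x (q x), by simp [hq]⟩⟩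

/-- A map `T → N` lifts to `M`, where it must vanish. This yields closure of `perpCat T` under
cokernels. -/
theorem perpCat_of_surjective (hT : HasProjectiveDimensionLE T 1) (g : M →ₗ[Rᵐᵒᵖ] N)
    (hg : Function.Surjective g) (hM : perpCat T M)
    (hK : extPerp T (ModuleCat.of Rᵐᵒᵖ (LinearMap.ker g))) : perpCat T N := by
  refine ⟨fun a => ?_, extPerp_of_surjective hT g hg hM.2⟩
  obtain ⟨b, rfl⟩ := exists_lift_of_subsingleton g hg ((extPerp_iff hT).1 hK) a
  rw [hM.1 b, LinearMap.comp_zero]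

/-- The canonical map from a direct sum of copies of `T` onto `M` has its kernel in `T^⊥`, so the
hypothesis splits it. -/
theorem IsTilting.add_of_ext_vanishing (hT : IsTilting T) (hM : extPerp T M)
    (h : ∀ N, extPerp T N → Subsingleton (Ext.{u} M N 1)) : Add T M := by
  obtain ⟨T₀, T₁, ⟨c⟩⟩ := hT.coresolution
  -- Indexing by all of `Hom(T, M)` makes each `a : T → M` lift through the inclusion of its own
  -- summand.
  let p : ((T →ₗ[Rᵐᵒᵖ] M) →₀ T) →ₗ[Rᵐᵒᵖ] M := Finsupp.lsum ℕ fun a => a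
  have hp : Function.Surjective p := by
    intro x
    obtain ⟨b, rfl⟩ := c.exists_hom ((c.mem_add₁.extPerp_le _ hM) 1 one_pos) x
    obtain ⟨I, q, s, hs⟩ := add_iff.1 c.mem_add₀
    rw [← hs (c.f 1)]
    generalize s (c.f 1) = y
    change b (q y) ∈ LinearMap.range p
    induction y using Finsupp.induction_linear with
    | zero => simp
    | add y z hy hz => simpa using add_mem hy hz
    | single i t => exact ⟨Finsupp.single (b ∘ₗ q ∘ₗ Finsupp.lsingle i) t, by simp [p]⟩
  have hK := extPerp_ker (M := ModuleCat.of Rᵐᵒᵖ ((T →ₗ[Rᵐᵒᵖ] M) →₀ T)) hT.projDim_le_one p hp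
    (hT.extPerp_of_add ((Add.refl T).finsupp _))
    fun a => ⟨Finsupp.lsingle a, by ext; simp [p]⟩
  obtain ⟨s, hs⟩ := exists_lift_of_subsingleton (T := M)
    (M := ModuleCat.of Rᵐᵒᵖ ((T →ₗ[Rᵐᵒᵖ] M) →₀ T)) p hp (h _ hK) LinearMap.id
  exact add_iff.2 ⟨_, p, s, LinearMap.congr_fun hs⟩

theorem TiltingEquivalent.add_of_add {T' : RightMod R} (hT : IsTilting T) (hT' : IsTilting T')
    (h : TiltingEquivalent T' T) (hM : Add T' M) : Add T M := by
  refine hT.add_of_ext_vanishing ?_ fun N hN => ?_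
  · rw [← h]
    exact hT'.extPerp_of_add hM
  · rw [← h] at hN
    exact hM.extPerp_le N hN 1 one_pos

/-- If `Ext¹(T₁, M) = 0`, then every map `R → M` extends to `T₀`, so `M` is a quotient of a direct
sum of copies of `T₀`; and `T^⊥` is closed under quotients. -/
theorem AddCoresolution.extPerp_prod {T₀ T₁ : RightMod R} (c : AddCoresolution T T₀ T₁)
    (hT : IsTilting T) : extPerp (ModuleCat.of Rᵐᵒᵖ (T₀ × T₁)) = extPerp T := by
  refine le_antisymm (fun M hM => ?_) (c.mem_add₀.prod c.mem_add₁).extPerp_le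
  have h₁ : Add (ModuleCat.of Rᵐᵒᵖ (T₀ × T₁)) T₁ :=
    (Add.refl _).of_retract (LinearMap.snd _ _ _) (LinearMap.inr _ _ _) fun x => by simp
  obtain ⟨p, hp⟩ := exists_finsupp_surjective fun x =>
    (c.exists_hom (h₁.extPerp_le M hM 1 one_pos) x).imp fun b hb => ⟨_, hb⟩
  exact extPerp_of_surjective (M := ModuleCat.of Rᵐᵒᵖ (M →₀ T₀)) hT.projDim_le_one p hp
    (hT.extPerp_of_add (c.mem_add₀.finsupp _))

theorem AddCoresolution.isTilting_prod {T₀ T₁ : RightMod R} (c : AddCoresolution T T₀ T₁)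
    (hT : IsTilting T) : IsTilting (ModuleCat.of Rᵐᵒᵖ (T₀ × T₁)) where
  projDim_le_one := (c.mem_add₀.prod c.mem_add₁).projDim_le_one hT.projDim_le_one
  ext_directSum I := by
    have h := hT.extPerp_of_add ((c.mem_add₀.prod c.mem_add₁).finsupp I)
    rw [← c.extPerp_prod hT] at h
    exact h 1 one_pos
  coresolution := ⟨T₀, T₁, ⟨{ c with
    mem_add₀ := (Add.refl _).of_retract (LinearMap.fst _ _ _) (LinearMap.inl _ _ _)
      fun x => by simp
    mem_add₁ := (Add.refl _).of_retract (LinearMap.snd _ _ _) (LinearMap.inr _ _ _)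
      fun x => by simp }⟩⟩

theorem AddCoresolution.perpCat_mem {T₀ T₁ : RightMod R} (c : AddCoresolution T T₀ T₁)
    (hT : IsTilting T) (h : ∀ f : T₁ →ₗ[Rᵐᵒᵖ] T₀, f = 0) (J : Type u) :
    perpCat T₁ (ModuleCat.of Rᵐᵒᵖ (J →₀ T₀)) := by
  refine ⟨fun f => ?_, c.mem_add₁.extPerp_le _ (hT.extPerp_of_add (c.mem_add₀.finsupp J))⟩
  ext x j
  exact LinearMap.congr_fun (h (Finsupp.lapply j ∘ₗ f)) x

/-- Uniqueness comes from `Hom(T₁, M) = 0` and existence from `Ext¹(T₁, M) = 0`. -/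
theorem AddCoresolution.bijective_comp {T₀ T₁ : RightMod R} (c : AddCoresolution T T₀ T₁)
    (hM : perpCat T₁ M) :
    Function.Bijective (fun b : T₀ →ₗ[Rᵐᵒᵖ] M => (b ∘ₗ c.f : R →ₗ[Rᵐᵒᵖ] M)) := by
  refine ⟨fun a b hab => ?_, fun a => ?_⟩
  · have hk : LinearMap.ker c.g ≤ LinearMap.ker (a - b) := fun x hx => by
      obtain ⟨r, rfl⟩ := (c.exact x).1 hx
      simpa [sub_eq_zero] using LinearMap.congr_fun hab r
    have h0 := hM.1 ((LinearMap.ker c.g).liftQ (a - b) hk ∘ₗ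
      (c.g.quotKerEquivOfSurjective c.surjective).symm.toLinearMap)
    ext x
    have := LinearMap.congr_fun h0 (c.g x)
    rw [LinearMap.comp_apply, LinearEquiv.coe_coe,
      show c.g x = c.g.quotKerEquivOfSurjective c.surjective (Submodule.Quotient.mk x) from rfl,
      LinearEquiv.symm_apply_apply] at this
    simpa [sub_eq_zero] using this
  · obtain ⟨b, hb⟩ := c.exists_hom (hM.2 1 one_pos) (a 1)
    exact ⟨b, hom_ext_one hb⟩

end RightMod

/-! ### Universal property of reflections, and modules over `Q_G` -/

section Reflection

variable {R : Type u} [Ring R]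

theorem RightMod.bijective_comp_unit {P : ObjectProperty (RightMod R)}
    {l : RightMod R ⥤ P.FullSubcategory} (adj : l ⊣ P.ι) (M C : RightMod R) (hC : P C) :
    Function.Bijective (fun f : (l.obj M).obj →ₗ[Rᵐᵒᵖ] C =>
      (f ∘ₗ (adj.unit.app M).hom : M →ₗ[Rᵐᵒᵖ] C)) := by
  let e := (ModuleCat.homEquiv (M := (l.obj M).obj) (N := C)).symm.trans
    ((P.fullyFaithfulι.homEquiv (X := l.obj M) (Y := ⟨C, hC⟩)).symm.trans
    ((adj.homEquiv _ _).trans ModuleCat.homEquiv))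
  exact e.bijective

theorem RightMod.additive_reflection {P : ObjectProperty (RightMod R)}
    {l : RightMod R ⥤ P.FullSubcategory} (adj : l ⊣ P.ι) : (l ⋙ P.ι).Additive := by
  have := adj.left_adjoint_additive
  infer_instance

end Reflection

namespace GabrielTopology

variable {R : Type u} [Ring R] (G : GabrielTopology R)

/-- The hypothesis identifies `M` with `Hom(Q_G, M)`, on which `Q_G` acts through left
multiplication on the source: `x q` is the value at `q` of the unique map sending `1` to `x`. -/
theorem essImage_of_bijective (M : RightMod R)
    (h : Function.Bijective (fun f : G.Q →ₗ[Rᵐᵒᵖ] M => f ∘ₗ G.unit)) :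
    (ModuleCat.restrictScalars.{u} (RingHom.op G.toQ)).essImage M := by
  have hext {f g : G.Q →ₗ[Rᵐᵒᵖ] M} (hfg : f 1 = g 1) : f = g := h.1 (RightMod.hom_ext_one hfg)
  have hex (x : M) : ∃ f : G.Q →ₗ[Rᵐᵒᵖ] M, f 1 = x := by
    obtain ⟨a, rfl⟩ := RightMod.exists_hom_apply_one M x
    obtain ⟨f, rfl⟩ := h.2 a
    exact ⟨f, rfl⟩
  choose F hF using hex
  let : Module G.Qᵐᵒᵖ M :=
    { smul := fun q x => F x q.unop
      one_smul := hF
      mul_smul := fun p q x => by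
        change F x (q.unop * p.unop) = F (F x q.unop) p.unop
        refine LinearMap.congr_fun (f := F x ∘ₗ G.mulLeft q.unop) (hext ?_) p.unop
        rw [hF]
        exact congrArg (F x) (mul_one q.unop)
      smul_zero := fun q => LinearMap.congr_fun (g := 0) (hext (hF 0)) q.unop
      smul_add := fun q x y => LinearMap.congr_fun (g := F x + F y)
        (hext (by simp [hF])) q.unop
      add_smul := fun p q x => map_add (F x) p.unop q.unop
      zero_smul := fun x => map_zero (F x) }
  have hs (r : Rᵐᵒᵖ) (x : M) : RingHom.op G.toQ r • x = r • x := by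
    change F x (G.unit r.unop) = r • x
    rw [RightMod.hom_apply (M := ModuleCat.of Rᵐᵒᵖ G.Q) G.unit, map_smul]
    exact congrArg _ (hF x)
  let e : (ModuleCat.restrictScalars.{u} (RingHom.op G.toQ)).obj (ModuleCat.of G.Qᵐᵒᵖ M)
      ≃ₗ[Rᵐᵒᵖ] M :=
    { AddEquiv.refl M with map_smul' := hs }
  exact ⟨ModuleCat.of G.Qᵐᵒᵖ M, ⟨e.toModuleIso⟩⟩

/-- Every `Q_G`-module has a presentation by a direct sum of copies of `Q_G`. -/
theorem exists_presentation (N : ModuleCat.{u} G.Qᵐᵒᵖ) :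
    ∃ p : (N →₀ G.Q) →ₗ[Rᵐᵒᵖ] (ModuleCat.restrictScalars.{u} (RingHom.op G.toQ)).obj N,
      Function.Surjective p ∧ ∃ N' : ModuleCat.{u} G.Qᵐᵒᵖ,
        Nonempty ((ModuleCat.restrictScalars.{u} (RingHom.op G.toQ)).obj N' ≃ₗ[Rᵐᵒᵖ]
          LinearMap.ker p) := by
  let t (x : N) : G.Q →ₗ[G.Qᵐᵒᵖ] N :=
    { toFun := fun q => op q • x
      map_add' := fun p q => by simp [add_smul]
      map_smul' := fun p q => by simp [mul_smul] }
  let P : (N →₀ G.Q) →ₗ[G.Qᵐᵒᵖ] N := Finsupp.lsum ℕ t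
  have hs (r : Rᵐᵒᵖ) (z : N →₀ G.Q) : r • z = (RingHom.op G.toQ r) • z := by
    ext x
    exact (G.mul_toQ (z x) r.unop).symm
  let p : (N →₀ G.Q) →ₗ[Rᵐᵒᵖ] (ModuleCat.restrictScalars.{u} (RingHom.op G.toQ)).obj N :=
    { toFun := P
      map_add' := map_add P
      map_smul' := fun r z => (congrArg P (hs r z)).trans (map_smul P _ z) }
  -- The kernel is returned as a restricted `Q_G`-module so that it can be presented in turn.
  refine ⟨p, fun x => ⟨Finsupp.single x 1, ?_⟩, ModuleCat.of _ (LinearMap.ker P),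
    ⟨{ AddEquiv.refl (LinearMap.ker P) with
       map_smul' := fun r z => Subtype.ext (hs r z.1).symm }⟩⟩
  exact (Finsupp.lsum_single ℕ t x 1).trans (one_smul _ _)

end GabrielTopology

/-! ### From Giraud subcategories to Gabriel topologies -/

namespace RightMod

variable {R : Type u} [Ring R]

/-- The modules without nonzero homomorphisms to the modules in `P`. -/
def leftOrthogonal (P : ObjectProperty (RightMod R)) : ObjectProperty (RightMod R) := fun N =>
  ∀ X : RightMod R, P X → ∀ f : N →ₗ[Rᵐᵒᵖ] X, f = 0

theorem leftOrthogonal_of_surjective {P : ObjectProperty (RightMod R)} {M N : RightMod R}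
    (hM : leftOrthogonal P M) (g : M →ₗ[Rᵐᵒᵖ] N) (hg : Function.Surjective g) :
    leftOrthogonal P N := by
  intro X hX f
  ext x
  obtain ⟨y, rfl⟩ := hg x
  exact LinearMap.congr_fun (hM X hX (f ∘ₗ g)) y

section Reflective

variable {P : ObjectProperty (RightMod R)} {l : RightMod R ⥤ P.FullSubcategory} (adj : l ⊣ P.ι)
include adj

/-- This puts the torsion condition in a form to which exactness of the reflection applies. -/
theorem leftOrthogonal_iff_isZero (N : RightMod R) :
    leftOrthogonal P N ↔ IsZero ((l ⋙ P.ι).obj N) := by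
  constructor
  · intro hN
    rw [IsZero.iff_id_eq_zero]
    refine ModuleCat.hom_ext ((bijective_comp_unit adj N _ (l.obj N).property).1 ?_)
    exact (hN _ (l.obj N).property _).trans (hN _ (l.obj N).property _).symm
  · intro h X hX f
    obtain ⟨g, rfl⟩ := (bijective_comp_unit adj N X hX).2 f
    have : g = 0 := congr($(h.eq_of_src (ModuleCat.ofHom g) 0).hom)
    simp [this]

variable [PreservesFiniteLimits l]

theorem preservesFiniteLimits_comp_ι : PreservesFiniteLimits (l ⋙ P.ι) := by
  have : PreservesLimits P.ι := adj.rightAdjoint_preservesLimits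
  exact comp_preservesFiniteLimits _ _

theorem leftOrthogonal_of_injective {M N : RightMod R} (hN : leftOrthogonal P N)
    (i : M →ₗ[Rᵐᵒᵖ] N) (hi : Function.Injective i) : leftOrthogonal P M := by
  have := preservesFiniteLimits_comp_ι adj
  rw [leftOrthogonal_iff_isZero adj] at hN ⊢
  have : Mono (ModuleCat.ofHom i) := (ModuleCat.mono_iff_injective _).2 hi
  exact IsZero.of_mono ((l ⋙ P.ι).map (ModuleCat.ofHom i)) hN

/-- Maps to modules in a Giraud subcategory extend along monomorphisms whose cokernel is
annihilated by the reflection. -/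
theorem exists_extension_of_leftOrthogonal {M N : RightMod R} (g : M →ₗ[Rᵐᵒᵖ] N)
    (hg : Function.Surjective g) (hN : leftOrthogonal P N) {X : RightMod R} (hX : P X)
    (f : LinearMap.ker g →ₗ[Rᵐᵒᵖ] X) :
    ∃ f' : M →ₗ[Rᵐᵒᵖ] X, f' ∘ₗ (LinearMap.ker g).subtype = f := by
  have hl := preservesFiniteLimits_comp_ι adj
  have := additive_reflection adj
  have hS := (LinearMap.shortExact_shortComplexKer hg)
  rw [((Functor.preservesFiniteLimits_tfae (l ⋙ P.ι)).out 3 0 :)] at hl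
  obtain ⟨h₁, h₂⟩ := hl _ hS
  have hz := (leftOrthogonal_iff_isZero adj N).1 hN
  -- The reflected inclusion of the kernel is mono by left exactness and epi because `N` reflects to
  -- zero; its inverse provides the extension.
  have : Epi ((l ⋙ P.ι).map (LinearMap.shortComplexKer g).f) :=
    h₁.epi_f (hz.eq_of_tgt _ _)
  have := isIso_of_mono_of_epi ((l ⋙ P.ι).map (LinearMap.shortComplexKer g).f)
  obtain ⟨k, hk⟩ := (bijective_comp_unit adj (LinearMap.shortComplexKer g).X₁ X hX).2 f
  refine ⟨(adj.unit.app M ≫ inv ((l ⋙ P.ι).map (LinearMap.shortComplexKer g).f) ≫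
    ModuleCat.ofHom k).hom, ?_⟩
  rw [← hk]
  have nat := adj.unit.naturality (LinearMap.shortComplexKer g).f
  have : (LinearMap.shortComplexKer g).f ≫ (adj.unit.app M ≫
      inv ((l ⋙ P.ι).map (LinearMap.shortComplexKer g).f) ≫ ModuleCat.ofHom k) =
      adj.unit.app _ ≫ ModuleCat.ofHom k := by
    have h2 : (LinearMap.shortComplexKer g).f ≫ adj.unit.app M =
      adj.unit.app _ ≫ (l ⋙ P.ι).map (LinearMap.shortComplexKer g).f := nat
    rw [← Category.assoc, h2, Category.assoc, IsIso.hom_inv_id_assoc]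
  exact congr(($this).hom)

/-- The inclusion of the kernel reflects to a map that is zero, by universality, and mono, by
exactness. -/
theorem ker_unit_leftOrthogonal (C : RightMod R) :
    leftOrthogonal P (ModuleCat.of Rᵐᵒᵖ (LinearMap.ker (adj.unit.app C).hom)) := by
  have := preservesFiniteLimits_comp_ι adj
  intro X hX f
  let K := ModuleCat.of Rᵐᵒᵖ (LinearMap.ker (adj.unit.app C).hom)
  let i : K ⟶ C := ModuleCat.ofHom (LinearMap.ker (adj.unit.app C).hom).subtype
  have : Mono i := (ModuleCat.mono_iff_injective _).2 Subtype.val_injective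
  have h0 : i ≫ adj.unit.app C = 0 := by
    ext x
    exact x.2
  have h1 : (l ⋙ P.ι).map i = 0 := by
    refine ModuleCat.hom_ext ((bijective_comp_unit adj K _ (l.obj C).property).1 ?_)
    have nat : i ≫ adj.unit.app C = adj.unit.app K ≫ (l ⋙ P.ι).map i := adj.unit.naturality i
    exact congr(($(nat.symm.trans h0)).hom)
  have hz : IsZero ((l ⋙ P.ι).obj K) := IsZero.of_mono_eq_zero _ h1
  exact (leftOrthogonal_iff_isZero adj K).2 hz X hX f

omit [PreservesFiniteLimits l] in
theorem coker_unit_leftOrthogonal (C : RightMod R) :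
    leftOrthogonal P (ModuleCat.of Rᵐᵒᵖ
      ((l.obj C).obj ⧸ LinearMap.range (adj.unit.app C).hom)) := by
  intro X hX f
  refine Submodule.linearMap_qext _ ((bijective_comp_unit adj C X hX).1 ?_)
  ext x
  have : Submodule.Quotient.mk (p := LinearMap.range (adj.unit.app C).hom)
      ((adj.unit.app C).hom x) = 0 := by simp
  simp [this]

end Reflective

theorem leftOrthogonal_quotient_of_mem {P : ObjectProperty (RightMod R)}
    {l : RightMod R ⥤ P.FullSubcategory} (adj : l ⊣ P.ι) [PreservesFiniteLimits l]
    {M : RightMod R} (hM : leftOrthogonal P M) (a : R →ₗ[Rᵐᵒᵖ] M) :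
    leftOrthogonal P (ModuleCat.of Rᵐᵒᵖ (R ⧸ LinearMap.ker a)) :=
  leftOrthogonal_of_injective adj hM ((LinearMap.ker a).liftQ a le_rfl)
    (LinearMap.ker_eq_bot.1 (Submodule.ker_liftQ_eq_bot _ _ _ le_rfl))

/-- The Gabriel topology of a Giraud subcategory: the right ideals `I` such that the reflection
of `R/I` vanishes. -/
def gabrielTopology {P : ObjectProperty (RightMod R)}
    {l : RightMod R ⥤ P.FullSubcategory} (adj : l ⊣ P.ι) [PreservesFiniteLimits l] :
    GabrielTopology R :=
  -- `R/(I : x)` is the cyclic submodule of `R/I` generated by the class of `x`.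
  have colon (I : Submodule Rᵐᵒᵖ R) (hI : leftOrthogonal P (ModuleCat.of Rᵐᵒᵖ (R ⧸ I))) (x : R) :
      leftOrthogonal P (ModuleCat.of Rᵐᵒᵖ (R ⧸ rightColon I x)) := by
    have := leftOrthogonal_quotient_of_mem adj hI (I.mkQ ∘ₗ LinearMap.mulLeft Rᵐᵒᵖ x)
    rwa [LinearMap.ker_comp, Submodule.ker_mkQ] at this
  have trans (K : Submodule Rᵐᵒᵖ R) (I : Submodule Rᵐᵒᵖ R)
      (hI : leftOrthogonal P (ModuleCat.of Rᵐᵒᵖ (R ⧸ I)))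
      (h : ∀ x ∈ I, leftOrthogonal P (ModuleCat.of Rᵐᵒᵖ (R ⧸ rightColon K x))) :
      leftOrthogonal P (ModuleCat.of Rᵐᵒᵖ (R ⧸ K)) := by
    intro X hX f
    -- For `x ∈ I`, the map `r ↦ f (x r)` factors through `R/(K : x)`, hence vanishes; so `f` comes
    -- from a map on `R/I`.
    have hle : I ≤ LinearMap.ker (f ∘ₗ K.mkQ) := fun x hx => by
      have h1 := h x hx X hX ((rightColon K x).liftQ (f ∘ₗ K.mkQ ∘ₗ LinearMap.mulLeft Rᵐᵒᵖ x)
        fun y hy => by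
          have : K.mkQ (x * y) = 0 := (Submodule.Quotient.mk_eq_zero _).2 hy
          simpa using congrArg f this)
      simpa using LinearMap.congr_fun h1 (Submodule.Quotient.mk 1)
    have h2 := hI X hX (I.liftQ _ hle)
    refine Submodule.linearMap_qext _ ?_
    ext
    simpa using LinearMap.congr_fun h2 (Submodule.Quotient.mk 1)
  { ideals := {I | leftOrthogonal P (ModuleCat.of Rᵐᵒᵖ (R ⧸ I))}
    nonempty := ⟨⊤, fun X hX f => by
      ext
      simp [Submodule.Quotient.subsingleton_iff.2 rfl |>.elim _ (0 : R ⧸ (⊤ : Submodule Rᵐᵒᵖ R))]⟩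
    mem_of_le := fun I hI K hle =>
      leftOrthogonal_of_surjective hI (Submodule.factor hle) (Submodule.factor_surjective hle)
    inf_mem := fun I hI K hK => trans _ I hI fun x hx => by
      have : rightColon (I ⊓ K) x = rightColon K x := by
        ext r
        have : x * r ∈ I := by simpa using I.smul_mem (op r) hx
        simp [rightColon, this]
      rw [this]
      exact colon K hK x
    colon_mem := colon
    mem_of_colon_mem := fun K ⟨I, hI, h⟩ => trans K I hI h }

/-- For closed `C`, the unit `C → l C` is an isomorphism because its kernel and cokernel are both
torsion. -/
theorem closed_gabrielTopology {P : ObjectProperty (RightMod R)}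
    {l : RightMod R ⥤ P.FullSubcategory} (adj : l ⊣ P.ι) [PreservesFiniteLimits l]
    (hP : ∀ {M N : RightMod R}, (M ≃ₗ[Rᵐᵒᵖ] N) → P M → P N) :
    (gabrielTopology adj).closed = P := by
  have hle : P ≤ (gabrielTopology adj).closed := by
    intro C hC I hI
    constructor
    · intro a b hab
      have h : I ≤ LinearMap.ker (a - b) := fun x hx => by
        simpa [sub_eq_zero] using LinearMap.congr_fun hab ⟨x, hx⟩
      have := LinearMap.congr_fun (hI C hC (I.liftQ (a - b) h)) (Submodule.Quotient.mk 1)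
      exact hom_ext_one (by simpa [sub_eq_zero] using this)
    · intro f
      obtain ⟨f', hf'⟩ := exists_extension_of_leftOrthogonal (M := ModuleCat.of Rᵐᵒᵖ R)
        (N := ModuleCat.of Rᵐᵒᵖ (R ⧸ I)) adj I.mkQ I.mkQ_surjective hI hC
        (f ∘ₗ (LinearEquiv.ofEq _ _ I.ker_mkQ).toLinearMap)
      refine ⟨f', ?_⟩
      ext x
      exact LinearMap.congr_fun hf' ⟨x.1, by simp⟩
  refine le_antisymm (fun C hC => ?_) hle
  have hinj : Function.Injective (adj.unit.app C).hom := by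
    rw [injective_iff_map_eq_zero]
    intro x hx
    obtain ⟨a, ha⟩ := exists_hom_apply_one
      (ModuleCat.of Rᵐᵒᵖ (LinearMap.ker (adj.unit.app C).hom)) ⟨x, hx⟩
    have := (hC _ (leftOrthogonal_quotient_of_mem adj (ker_unit_leftOrthogonal adj C) a)).1
      (a₁ := Submodule.subtype _ ∘ₗ a) (a₂ := 0) (by
        ext r
        have : a r.1 = 0 := r.2
        simp [this])
    simpa [ha] using LinearMap.congr_fun this (1 : R)
  have hsurj : Function.Surjective (adj.unit.app C).hom := by
    intro y
    obtain ⟨b, hb⟩ := exists_hom_apply_one _ y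
    let a := (LinearMap.range (adj.unit.app C).hom).mkQ ∘ₗ b
    -- `ker a` consists of the `r` for which `y r` lies in the image of `C`. On it, `r ↦ y r` lifts
    -- to `C`; extending the lift to `R` gives a preimage of `y`, since maps into `l C` are
    -- determined on `ker a`.
    have hI := leftOrthogonal_quotient_of_mem adj (coker_unit_leftOrthogonal adj C) a
    let e := LinearEquiv.ofInjective _ hinj
    let b' : LinearMap.ker a →ₗ[Rᵐᵒᵖ] LinearMap.range (adj.unit.app C).hom :=
      (b ∘ₗ (LinearMap.ker a).subtype).codRestrict _ fun r =>
        (Submodule.Quotient.mk_eq_zero _).1 r.2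
    obtain ⟨c, hc⟩ := (hC _ hI).2 (e.symm.toLinearMap ∘ₗ b')
    refine ⟨c 1, ?_⟩
    have h2 := (hle _ (l.obj C).property _ hI).1 (a₁ := (adj.unit.app C).hom ∘ₗ c) (a₂ := b) (by
      ext r
      have h3 := congrArg e (LinearMap.congr_fun hc r)
      simp only [LinearMap.comp_apply, LinearEquiv.coe_coe, LinearEquiv.apply_symm_apply] at h3
      exact congrArg Subtype.val h3)
    rw [← hb, ← h2, LinearMap.comp_apply]
  exact hP (LinearEquiv.ofBijective _ ⟨hinj, hsurj⟩).symm (l.obj C).property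

end RightMod

/-! ### Exactness of the reflection onto closed modules -/

namespace GabrielTopology

variable {R : Type u} [Ring R] (G : GabrielTopology R)

/-- An element of a right module is torsion if it is annihilated by a right ideal in `G`. -/
def IsTorsionElt {M : RightMod R} (x : M) : Prop := ∃ I ∈ G.ideals, ∀ r ∈ I, op r • x = 0

variable {G} {A B C : RightMod R}

theorem IsTorsionElt.eq_zero (hC : G.closed C) {x : C} (hx : G.IsTorsionElt x) : x = 0 := by
  obtain ⟨I, hI, h⟩ := hx
  obtain ⟨a, rfl⟩ := RightMod.exists_hom_apply_one C x
  refine LinearMap.congr_fun (g := 0) ((hC I hI).1 ?_) (1 : R)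
  ext r
  simpa [RightMod.hom_apply a r.1] using h r r.2

variable (G) in
/-- The unit `A → ℓ A` of the reflection onto the `G`-closed modules. -/
noncomputable def η (A : RightMod R) : A →ₗ[Rᵐᵒᵖ] (G.reflector.obj A).obj := (G.adj.unit.app A).hom

variable (G) in
/-- The linear map `ℓ A → ℓ B` induced by `f : A → B`. -/
noncomputable def mapL (f : A →ₗ[Rᵐᵒᵖ] B) :
    (G.reflector.obj A).obj →ₗ[Rᵐᵒᵖ] (G.reflector.obj B).obj :=
  ((G.reflector ⋙ G.closed.ι).map (ModuleCat.ofHom f)).hom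

theorem bijective_comp_η (hC : G.closed C) :
    Function.Bijective (fun f : (G.reflector.obj A).obj →ₗ[Rᵐᵒᵖ] C => f ∘ₗ G.η A) :=
  RightMod.bijective_comp_unit G.adj A C hC

theorem mapL_η (f : A →ₗ[Rᵐᵒᵖ] B) (x : A) : G.mapL f (G.η A x) = G.η B (f x) :=
  congr(($((G.adj.unit.naturality (ModuleCat.ofHom f)).symm)).hom x)

/-- The elements of a module which are torsion modulo `N` form a submodule. -/
def torsionClosure (G : GabrielTopology R) (N : Submodule Rᵐᵒᵖ A) : Submodule Rᵐᵒᵖ A where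
  carrier := {x | ∃ I ∈ G.ideals, ∀ r ∈ I, op r • x ∈ N}
  zero_mem' := by
    obtain ⟨I, hI⟩ := G.nonempty
    exact ⟨I, hI, fun r _ => by simp⟩
  add_mem' := by
    rintro x y ⟨I, hI, hx⟩ ⟨J, hJ, hy⟩
    exact ⟨I ⊓ J, G.inf_mem I hI J hJ, fun r hr => by
      simpa using add_mem (hx r hr.1) (hy r hr.2)⟩
  smul_mem' := by
    rintro s x ⟨I, hI, hx⟩
    refine ⟨_, G.colon_mem I hI s.unop, fun r hr => ?_⟩
    simpa [smul_smul] using hx (s.unop * r) hr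

theorem closed_torsionClosure (hA : G.closed A) (N : Submodule Rᵐᵒᵖ A) :
    G.closed (ModuleCat.of Rᵐᵒᵖ (G.torsionClosure N)) := by
  intro I hI
  constructor
  · intro a b hab
    have := (hA I hI).1 (a₁ := Submodule.subtype _ ∘ₗ a) (a₂ := Submodule.subtype _ ∘ₗ b)
      (congrArg (fun f => Submodule.subtype _ ∘ₗ f) hab)
    ext : 2
    exact LinearMap.congr_fun this (1 : R)
  · intro h
    obtain ⟨k, hk⟩ := (hA I hI).2 (Submodule.subtype _ ∘ₗ h)
    have hk1 (r : R) (hr : r ∈ I) : k r = h ⟨r, hr⟩ := LinearMap.congr_fun hk ⟨r, hr⟩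
    have hmem : k 1 ∈ G.torsionClosure N := by
      refine ⟨N.comap k, G.mem_of_colon_mem _ ⟨I, hI, fun x hx => ?_⟩, fun r hr => ?_⟩
      · obtain ⟨J, hJ, h'⟩ := (h ⟨x, hx⟩).2
        refine G.mem_of_le J hJ _ fun r hr => ?_
        change k (x * r) ∈ N
        rw [show x * r = op r • x from rfl, map_smul, hk1 x hx]
        exact h' r hr
      · rw [← RightMod.hom_apply]
        exact hr
    refine ⟨k.codRestrict _ fun r => ?_, ?_⟩
    · rw [RightMod.hom_apply]
      exact Submodule.smul_mem _ _ hmem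
    · ext r
      exact hk1 r r.2

/-- The torsion closure of the image of `η` is itself closed, so universality forces it to be all of
the reflection. -/
theorem exists_mem_ideals_range_η (y : (G.reflector.obj A).obj) :
    ∃ I ∈ G.ideals, ∀ r ∈ I, op r • y ∈ LinearMap.range (G.η A) := by
  let N := G.torsionClosure (LinearMap.range (G.η A))
  have hle (x : A) : G.η A x ∈ N := by
    obtain ⟨I, hI⟩ := G.nonempty
    exact ⟨I, hI, fun r _ => Submodule.smul_mem _ _ ⟨x, rfl⟩⟩
  obtain ⟨f, hf⟩ := (bijective_comp_η (closed_torsionClosure (G.reflector.obj A).property _)).2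
    ((G.η A).codRestrict N hle)
  have h : N.subtype ∘ₗ f = LinearMap.id := by
    refine (bijective_comp_η (G.reflector.obj A).property).1 ?_
    ext x
    exact congrArg Subtype.val (LinearMap.congr_fun hf x)
  have := (f y).2
  rwa [show (f y).1 = y from LinearMap.congr_fun h y] at this

/-- If the `G`-closed modules are closed under cokernels, then the reflection is right exact. -/
theorem mem_range_mapL
    (hcok : ∀ {M N L : RightMod R} (f : M →ₗ[Rᵐᵒᵖ] N) (g : N →ₗ[Rᵐᵒᵖ] L), Function.Exact f g →
      Function.Surjective g → G.closed M → G.closed N → G.closed L)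
    (f : A →ₗ[Rᵐᵒᵖ] B) (g : B →ₗ[Rᵐᵒᵖ] C) (hfg : Function.Exact f g)
    (hg : Function.Surjective g) (y : (G.reflector.obj B).obj) (hy : G.mapL g y = 0) :
    y ∈ LinearMap.range (G.mapL f) := by
  -- The cokernel of `mapL f` is closed, so `B → coker` factors through `C` and then through its
  -- reflection; hence `q` factors through `mapL g`.
  let q := (LinearMap.range (G.mapL f)).mkQ
  have hD : G.closed (ModuleCat.of Rᵐᵒᵖ
      ((G.reflector.obj B).obj ⧸ LinearMap.range (G.mapL f))) :=
    hcok (G.mapL f) q (fun x => by simp [q]) (Submodule.mkQ_surjective _)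
      (G.reflector.obj A).property (G.reflector.obj B).property
  have hker : LinearMap.ker g ≤ LinearMap.ker (q ∘ₗ G.η B) := fun x hx => by
    obtain ⟨a, rfl⟩ := (hfg x).1 hx
    simp [q, ← mapL_η]
  let c := (LinearMap.ker g).liftQ _ hker ∘ₗ (g.quotKerEquivOfSurjective hg).symm.toLinearMap
  have hc (x : B) : c (g x) = q (G.η B x) := by
    have : (g.quotKerEquivOfSurjective hg).symm (g x) = Submodule.Quotient.mk x :=
      (LinearEquiv.symm_apply_eq _).2 rfl
    simp [c, this]
  obtain ⟨d, hd⟩ := (bijective_comp_η hD).2 c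
  have h : d ∘ₗ G.mapL g = q := by
    refine (bijective_comp_η hD).1 ?_
    ext x
    simp only [LinearMap.comp_apply, mapL_η, ← hc]
    exact LinearMap.congr_fun hd (g x)
  have := LinearMap.congr_fun h y
  rw [LinearMap.comp_apply, hy, map_zero] at this
  exact (Submodule.Quotient.mk_eq_zero _).1 this.symm

theorem injective_η_finsupp (hinj : Function.Injective G.toQ) (J : Type u)
    (hQ : G.closed (ModuleCat.of Rᵐᵒᵖ (J →₀ G.Q))) :
    Function.Injective (G.η (ModuleCat.of Rᵐᵒᵖ (J →₀ R))) := by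
  obtain ⟨f, hf⟩ := (bijective_comp_η (A := ModuleCat.of Rᵐᵒᵖ (J →₀ R)) hQ).2
    (Finsupp.mapRange.linearMap G.unit)
  refine Function.Injective.of_comp (f := f) ?_
  rw [← LinearMap.coe_comp]
  have : f ∘ₗ G.η (ModuleCat.of Rᵐᵒᵖ (J →₀ R)) = Finsupp.mapRange.linearMap G.unit := hf
  rw [this]
  exact Finsupp.mapRange_injective _ (map_zero _) hinj

/-- Present `A` as `F/K` with `F` free and lift `a` to `x`. Then `η x` comes from the reflection of
`K`, whose elements are torsion modulo `K`; as `η` is injective on `F`, some `I` in the topology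
sends `x` into `K`. -/
theorem isTorsionElt_of_η_eq_zero
    (hcok : ∀ {M N L : RightMod R} (f : M →ₗ[Rᵐᵒᵖ] N) (g : N →ₗ[Rᵐᵒᵖ] L), Function.Exact f g →
      Function.Surjective g → G.closed M → G.closed N → G.closed L)
    (hinj : Function.Injective G.toQ)
    (hQ : ∀ J : Type u, G.closed (ModuleCat.of Rᵐᵒᵖ (J →₀ G.Q)))
    (a : A) (ha : G.η A a = 0) : G.IsTorsionElt a := by
  obtain ⟨p, hp⟩ := RightMod.exists_finsupp_surjective (M := A) (Q := ModuleCat.of Rᵐᵒᵖ R)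
    fun x => (RightMod.exists_hom_apply_one A x).imp fun b hb => ⟨1, hb⟩
  obtain ⟨x, rfl⟩ := hp a
  let K := ModuleCat.of Rᵐᵒᵖ (LinearMap.ker p)
  let F := ModuleCat.of Rᵐᵒᵖ (A →₀ R)
  let i : K →ₗ[Rᵐᵒᵖ] F := (LinearMap.ker p).subtype
  obtain ⟨z, hz⟩ := mem_range_mapL (A := K) (B := F) hcok i p
    (fun y => by simp [i, K, F]) hp (G.η F x) ((mapL_η (A := F) p x).trans ha)
  obtain ⟨I, hI, h⟩ := exists_mem_ideals_range_η z
  refine ⟨I, hI, fun r hr => ?_⟩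
  obtain ⟨k, hk⟩ := h r hr
  have : op r • x = i k := by
    refine injective_η_finsupp hinj A (hQ A) ?_
    change G.η F (op r • x) = G.η F (i k)
    rw [map_smul, ← hz, ← map_smul, ← hk, mapL_η]
  rw [← map_smul, this]
  exact k.2

theorem isGiraud_closed
    (hcok : ∀ {M N L : RightMod R} (f : M →ₗ[Rᵐᵒᵖ] N) (g : N →ₗ[Rᵐᵒᵖ] L), Function.Exact f g →
      Function.Surjective g → G.closed M → G.closed N → G.closed L)
    (hinj : Function.Injective G.toQ)
    (hQ : ∀ J : Type u, G.closed (ModuleCat.of Rᵐᵒᵖ (J →₀ G.Q))) :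
    RightMod.IsGiraud G.closed := by
  -- If `y` is killed, each multiple `y r = η a` with `r ∈ I` has `f a` torsion, so `a` is torsion
  -- and `η a = 0`; thus `y` is torsion in a closed module.
  have hmono {A B : RightMod R} (f : A →ₗ[Rᵐᵒᵖ] B) (hf : Function.Injective f) :
      Function.Injective (G.mapL f) := by
    rw [injective_iff_map_eq_zero]
    intro y hy
    obtain ⟨I, hI, h⟩ := exists_mem_ideals_range_η y
    refine IsTorsionElt.eq_zero (G.reflector.obj A).property ⟨I, hI, fun r hr => ?_⟩
    obtain ⟨a, ha⟩ := h r hr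
    have h0 : G.η B (f a) = 0 := by rw [← mapL_η, ha, map_smul, hy, smul_zero]
    obtain ⟨J, hJ, h'⟩ := isTorsionElt_of_η_eq_zero hcok hinj hQ _ h0
    rw [← ha]
    refine IsTorsionElt.eq_zero (G.reflector.obj A).property ⟨J, hJ, fun s hs => ?_⟩
    have : op s • a = 0 := hf (by rw [map_smul, h' s hs, map_zero])
    rw [← map_smul, this, map_zero]
  have := RightMod.additive_reflection G.adj
  have hL : PreservesFiniteLimits (G.reflector ⋙ G.closed.ι) := by
    rw [((Functor.preservesFiniteLimits_tfae (G.reflector ⋙ G.closed.ι)).out 3 0 :)]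
    refine fun S hS => ⟨?_, ?_⟩
    · rw [ShortComplex.moduleCat_exact_iff]
      intro y hy
      exact mem_range_mapL hcok S.f.hom S.g.hom
        ((ShortComplex.ShortExact.moduleCat_exact_iff_function_exact S).1 hS.exact)
        hS.moduleCat_surjective_g y hy
    · exact (ModuleCat.mono_iff_injective _).2 (hmono S.f.hom hS.moduleCat_injective_f)
  refine ⟨G.reflector, ⟨G.adj⟩, ⟨fun J _ _ => ?_⟩, ?_⟩
  · exact preservesLimitsOfShape_of_reflects_of_preserves G.reflector G.closed.ι
  · have : PreservesColimits G.reflector := G.adj.leftAdjoint_preservesColimits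
    infer_instance

end GabrielTopology

/-! ### The two implications -/

namespace RightMod

variable {R : Type u} [Ring R] {T : RightMod R}

theorem arisesFromPerfectLocalization_of_isGiraud {T₀ T₁ : RightMod R} (hT : IsTilting T)
    (c : AddCoresolution T T₀ T₁) (h₀ : ∀ f : T₁ →ₗ[Rᵐᵒᵖ] T₀, f = 0)
    (hG : IsGiraud (perpCat T₁)) : T.ArisesFromPerfectLocalization := by
  obtain ⟨l, ⟨adj⟩, _, _⟩ := hG
  let G := gabrielTopology adj
  have hG : G.closed = perpCat T₁ := closed_gabrielTopology adj perpCat_of_linearEquiv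
  have hT₁ := c.mem_add₁.projDim_le_one hT.projDim_le_one
  have hT₀ : perpCat T₁ T₀ := ⟨h₀, c.mem_add₁.extPerp_le _ (hT.extPerp_of_add c.mem_add₀)⟩
  have hQ : perpCat T₁ (ModuleCat.of Rᵐᵒᵖ G.Q) := hG ▸ G.closed_Q
  obtain ⟨a, ha⟩ := (c.bijective_comp hQ).2 G.unit
  obtain ⟨b, hb⟩ := (G.bijective_comp_unit T₀ (hG ▸ hT₀)).2 c.f
  dsimp only at ha hb
  -- Both `R → Q_G` and `R → T₀` are universal among maps from `R` to modules in `perpCat T₁`.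
  have hab : a ∘ₗ b = LinearMap.id := (G.bijective_comp_unit _ G.closed_Q).1 (by
    dsimp only
    rw [LinearMap.comp_assoc, hb, ha, LinearMap.id_comp])
  have hba : b ∘ₗ a = LinearMap.id := (c.bijective_comp hT₀).1 (by
    dsimp only
    rw [LinearMap.comp_assoc, ha, hb, LinearMap.id_comp])
  have hinj : Function.Injective G.unit := by
    refine Function.Injective.of_comp (f := b) ?_
    rw [← LinearMap.coe_comp, hb]
    exact c.injective
  have hmem₀ : Add T (ModuleCat.of Rᵐᵒᵖ G.Q) :=
    c.mem_add₀.of_retract a b (LinearMap.congr_fun hab)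
  let e : T₀ ≃ₗ[Rᵐᵒᵖ] G.Q := LinearEquiv.ofLinearMap a b hab hba
  have hker : (LinearMap.ker c.g).map e.toLinearMap = LinearMap.range G.unit := by
    rw [c.exact.linearMap_ker_eq, ← LinearMap.range_comp]
    exact congrArg LinearMap.range ha
  let e₁ : T₁ ≃ₗ[Rᵐᵒᵖ] (G.Q ⧸ LinearMap.range G.unit) :=
    (c.g.quotKerEquivOfSurjective c.surjective).symm.trans (Submodule.Quotient.equiv _ _ e hker)
  let c' : AddCoresolution T (ModuleCat.of Rᵐᵒᵖ G.Q)
      (ModuleCat.of Rᵐᵒᵖ (G.Q ⧸ LinearMap.range G.unit)) :=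
    { f := G.unit
      g := (LinearMap.range G.unit).mkQ
      injective := hinj
      exact := G.unit.exact_map_mkQ_range
      surjective := Submodule.mkQ_surjective _
      mem_add₀ := hmem₀
      mem_add₁ := c.mem_add₁.of_retract e₁.toLinearMap e₁.symm.toLinearMap fun x => by simp }
  refine ⟨G, le_antisymm ?_ fun M hM => ?_, hinj, c'.isTilting_prod hT, c'.extPerp_prod hT⟩
  · have hQJ (J : Type u) : perpCat T₁ (ModuleCat.of Rᵐᵒᵖ (J →₀ G.Q)) :=
      perpCat_of_linearEquiv (M := ModuleCat.of Rᵐᵒᵖ (J →₀ T₀))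
        (Finsupp.mapRange.linearEquiv e) (c.perpCat_mem hT h₀ J)
    rintro M ⟨N, ⟨i⟩⟩
    rw [hG]
    refine perpCat_of_linearEquiv i.toLinearEquiv ?_
    obtain ⟨p, hp, N', ⟨e'⟩⟩ := G.exists_presentation N
    -- Only a surjection onto `ker p` is needed, because `T₁^⊥` is closed under quotients.
    obtain ⟨p', hp', -⟩ := G.exists_presentation N'
    exact perpCat_of_surjective (M := ModuleCat.of Rᵐᵒᵖ (N →₀ G.Q)) hT₁ p hp (hQJ N)
      (extPerp_of_surjective (M := ModuleCat.of Rᵐᵒᵖ (N' →₀ G.Q)) hT₁ (e'.toLinearMap ∘ₗ p')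
        (e'.surjective.comp hp') (hQJ N').2)
  · exact G.essImage_of_bijective M (G.bijective_comp_unit M hM)

theorem ArisesFromPerfectLocalization.exists_isGiraud (hT : IsTilting T)
    (h : T.ArisesFromPerfectLocalization) :
    ∃ T₀ T₁ : RightMod R, Nonempty (AddCoresolution T T₀ T₁) ∧
      (∀ f : T₁ →ₗ[Rᵐᵒᵖ] T₀, f = 0) ∧ IsGiraud (perpCat T₁) := by
  obtain ⟨G, hperf, hinj, hTG, heq⟩ := h
  let T₀ := ModuleCat.of Rᵐᵒᵖ G.Q
  let T₁ := ModuleCat.of Rᵐᵒᵖ (G.Q ⧸ LinearMap.range G.unit)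
  let c : AddCoresolution G.sumQuotient T₀ T₁ :=
    { f := G.unit
      g := (LinearMap.range G.unit).mkQ
      injective := hinj
      exact := G.unit.exact_map_mkQ_range
      surjective := Submodule.mkQ_surjective _
      mem_add₀ := (Add.refl G.sumQuotient).of_retract (LinearMap.fst _ _ _) (LinearMap.inl _ _ _)
        fun x => rfl
      mem_add₁ := (Add.refl G.sumQuotient).of_retract (LinearMap.snd _ _ _) (LinearMap.inr _ _ _)
        fun x => rfl }
  have hT₁ := c.mem_add₁.projDim_le_one hTG.projDim_le_one
  have hext {J : Type u} {N : RightMod R} (p : (J →₀ G.Q) →ₗ[Rᵐᵒᵖ] N)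
      (hp : Function.Surjective p) : extPerp T₁ N :=
    extPerp_of_surjective (M := ModuleCat.of Rᵐᵒᵖ (J →₀ T₀)) hT₁ p hp
      (c.mem_add₁.extPerp_le _ (hTG.extPerp_of_add (c.mem_add₀.finsupp J)))
  have hhom {N : RightMod R} (hN : G.closed N) (f : T₁ →ₗ[Rᵐᵒᵖ] N) : f = 0 := by
    refine Submodule.linearMap_qext _ ((G.bijective_comp_unit N hN).1 ?_)
    ext
    have : Submodule.Quotient.mk (p := LinearMap.range G.unit) (G.unit 1) = 0 := by simp
    simp [this]
  -- Closed modules are quotients of direct sums of copies of `Q_G`, hence lie in `T₁^⊥`; modules in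
  -- `perpCat T₁` are `Q_G`-modules, hence closed by perfectness.
  have hclosed : G.closed = perpCat T₁ := by
    refine le_antisymm (fun N hN => ⟨hhom hN, ?_⟩) fun N hN => ?_
    · rw [← hperf]
      exact G.essImage_of_bijective N (c.bijective_comp hN)
    · obtain ⟨p, hp⟩ := exists_finsupp_surjective (M := N) (Q := T₀) fun x =>
        (G.existsUnique_hom N hN x).exists.imp fun b hb => ⟨_, hb⟩
      exact hext p hp
  have hcok {M N L : RightMod R} (f : M →ₗ[Rᵐᵒᵖ] N) (g : N →ₗ[Rᵐᵒᵖ] L) (hfg : Function.Exact f g)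
      (hg : Function.Surjective g) (hM : G.closed M) (hN : G.closed N) : G.closed L := by
    rw [hclosed] at hM hN ⊢
    refine perpCat_of_surjective hT₁ g hg hN ?_
    rw [hfg.linearMap_ker_eq]
    exact extPerp_of_surjective hT₁ f.rangeRestrict f.surjective_rangeRestrict hM.2
  refine ⟨T₀, T₁, ⟨{ c with
    mem_add₀ := heq.add_of_add hT hTG c.mem_add₀
    mem_add₁ := heq.add_of_add hT hTG c.mem_add₁ }⟩, hhom G.closed_Q, ?_⟩
  rw [← hclosed]
  refine GabrielTopology.isGiraud_closed hcok hinj fun J => ?_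
  rw [hclosed]
  exact c.perpCat_mem hTG (hhom G.closed_Q) J

end RightMod

theorem theorem3p6 {R : Type u} [Ring R] (T : RightMod R) (hT : RightMod.IsTilting T) :
    (∃ T₀ T₁ : RightMod R, Nonempty (RightMod.AddCoresolution T T₀ T₁) ∧
      (∀ f : T₁ →ₗ[Rᵐᵒᵖ] T₀, f = 0) ∧ RightMod.IsGiraud (RightMod.perpCat T₁)) ↔
    RightMod.ArisesFromPerfectLocalization T :=
  ⟨fun ⟨_, _, ⟨c⟩, h₀, hG⟩ => RightMod.arisesFromPerfectLocalization_of_isGiraud hT c h₀ hG,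
    fun h => h.exists_isGiraud hT⟩
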